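/- Let $\Bbbk$ be an algebraically closed field of characteristic zero and $H=\Bbbk[\partial]$. Let $L$ be a Lie conformal algebra over $\Bbbk$ (with $\lambda$-bracket $[a_\lambda b]\in L[\lambda]$) that is finitely generated and torsion-free as an $H$-module. Let $R$ be the radical (the maximal solvable ideal) of $L$, and assume that it splits: $L=L_0\ltimes R$, where $L_0$ is a semisimple conformal subalgebra (one without nonzero solvable ideals). Assume that $R$ is nilpotent, and let $R=R^1\supseteq R^2\supseteq\cdots$, $R^{l+1}=\sum_{\alpha\in\Bbbk}[R_\alpha R^l]$, be its lower central series. Let $L_1$ be a direct summand of $L_0$ (that is, $L_0=L_1\oplus L_1'$ for ideals $L_1,L_1'$ of $L_0$) that is isomorphic, as a conformal algebra, either to the Virasoro conformal algebra $\mathrm{Vir}=Hv$, $[v_\lambda v]=(\partial+2\lambda)v$, or to $\mathrm{Vir}\ltimes\mathrm{Cur}\,\mathfrak g=Hv\oplus(H\otimes\mathfrak g)$ for a finite-dimensional simple Lie algebra $\mathfrak g$ over $\Bbbk$, where $[v_\lambda v]=(\partial+2\lambda)v$, $[v_\lambda a]=(\partial+\lambda)a$ and $[a_\lambda b]=[a,b]$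 for $a,b\in\mathfrak g$. Suppose that $R$ is a nontrivial conformal $L_1$-module under the adjoint action, i.e. $[{L_1}_\lambda R]\neq 0$. Then $L$ has a nonzero ideal $I$ with $I\cap Z(L)=0$ and $[R_\lambda I]=0$, where $Z(L)$ is the center of $L$. More precisely, there is a largest $m$ such that $R^m$ is a nontrivial $L_1$-module, and $I$ can be chosen to be an irreducible conformal $L_1$-submodule of $R^m$ (an $H$-submodule on which $L_1$ acts nontrivially and whose only conformal $L_1$-submodules are $0$ and $I$). -/

import Mathlib

open Polynomial TensorProduct

universe u v w

noncomputable section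

/-!
Conventions. `k` is the ground field and `H = k[X]`, where the indeterminate `X` plays the role
of `∂`.  For an `H`-module `L`, the space `L[λ]` is `PolynomialModule k[X] L`.  It is a module over
`k[X][X] = k[∂][λ]`, in which `λ` is the outer variable `X` and `∂` is `C X`.  For `p : k[X]`, the map
`PolynomialModule.eval p : L[λ] → L` is the substitution `λ ↦ p` (with `p` acting from the left
on the coefficients, as in `[b_{(-∂-α)} a]`).
-/

/-- A Lie conformal algebra over `k`: an `H`-module `L` with a `k`-bilinear `λ`-bracket
`[a_λ b] ∈ L[λ]` subject to sesquilinearity, anti-commutativity and the Jacobi identity (the last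
two are written, as usual, for all values `α, β ∈ k` of the formal variables). -/
class LieConformalAlgebra (k : Type u) (L : Type v) [Field k] [AddCommGroup L] [Module k L]
    [Module k[X] L] [IsScalarTower k k[X] L] where
  /-- the `λ`-bracket `[a_λ b]` -/
  br : L →ₗ[k] L →ₗ[k] PolynomialModule k[X] L
  /-- `[∂a_λ b] = -λ [a_λ b]` -/
  br_d_left : ∀ a b : L, br ((X : k[X]) • a) b = (-X : k[X][X]) • br a b
  /-- `[a_λ ∂b] = (λ + ∂) [a_λ b]` -/
  br_d_right : ∀ a b : L, br a ((X : k[X]) • b) = (X + C X : k[X][X]) • br a b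
  /-- `[a_α b] = -[b_{-∂-α} a]` -/
  anticomm : ∀ (a b : L) (α : k),
    PolynomialModule.eval (C α) (br a b) = -PolynomialModule.eval (-X - C α) (br b a)
  /-- `[a_α [b_β c]] - [b_β [a_α c]] = [[a_α b]_{α+β} c]` -/
  jacobi : ∀ (a b c : L) (α β : k),
    PolynomialModule.eval (C α) (br a (PolynomialModule.eval (C β) (br b c)))
      - PolynomialModule.eval (C β) (br b (PolynomialModule.eval (C α) (br a c)))
      = PolynomialModule.eval (C (α + β)) (br (PolynomialModule.eval (C α) (br a b)) c)

namespace LieConformalAlgebra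

section Notions

variable (k : Type u) {L : Type v} [Field k] [AddCommGroup L] [Module k L]
  [Module k[X] L] [IsScalarTower k k[X] L] [LieConformalAlgebra k L]

/-- `[A_λ B] ⊆ N[λ]`. -/
def BracketLE (A B N : Submodule k[X] L) : Prop :=
  ∀ a ∈ A, ∀ b ∈ B, ∀ n : ℕ, (br (k := k) a b).coeff n ∈ N

/-- `[A_λ B] = 0`. For `A` a subalgebra and `B` a conformal `A`-submodule of `L` under the adjoint
action, this says that `B` is a trivial `A`-module. -/
def BracketZero (A B : Submodule k[X] L) : Prop :=
  ∀ a ∈ A, ∀ b ∈ B, br (k := k) a b = 0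

/-- The `H`-submodule `[A, B]` spanned by all coefficients of all `[a_λ b]`, `a ∈ A`, `b ∈ B`.
As `k` is infinite in our applications, it equals `∑_{α ∈ k} [A_α B]`. -/
def bracketSpan (A B : Submodule k[X] L) : Submodule k[X] L :=
  Submodule.span k[X] {x | ∃ a ∈ A, ∃ b ∈ B, ∃ n : ℕ, (br (k := k) a b).coeff n = x}

/-- `A` is a conformal subalgebra of `L`. -/
def IsSubalgebra (A : Submodule k[X] L) : Prop := BracketLE k A A A

/-- `I` is an ideal of the subalgebra `A`. (By anti-commutativity, left ideals are two-sided.) -/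
def IsIdealOf (A I : Submodule k[X] L) : Prop := I ≤ A ∧ BracketLE k A I I

/-- `I` is an ideal of `L`. -/
def IsIdeal (I : Submodule k[X] L) : Prop := IsIdealOf k ⊤ I

/-- The derived series `A, [A, A], [[A, A], [A, A]], …`. -/
def derivedSeries (A : Submodule k[X] L) : ℕ → Submodule k[X] L
  | 0 => A
  | n + 1 => bracketSpan k (derivedSeries A n) (derivedSeries A n)

/-- The lower central series `A, [A, A], [A, [A, A]], …`; the term with index `n` here is the one
usually written `A^{n+1}`. -/
def lowerCentralSeries (A : Submodule k[X] L) : ℕ → Submodule k[X] L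
  | 0 => A
  | n + 1 => bracketSpan k A (lowerCentralSeries A n)

/-- `A` is solvable. -/
def IsSolvable (A : Submodule k[X] L) : Prop := ∃ n, derivedSeries k A n = ⊥

/-- `A` is nilpotent. -/
def IsNilpotent (A : Submodule k[X] L) : Prop := ∃ n, lowerCentralSeries k A n = ⊥

/-- The subalgebra `A` has no nonzero solvable ideals. -/
def IsSemisimple (A : Submodule k[X] L) : Prop :=
  ∀ I : Submodule k[X] L, IsIdealOf k A I → IsSolvable k I → I = ⊥

/-- `R` is the radical of `L`, i.e. its maximal solvable ideal. -/
def IsRadical (R : Submodule k[X] L) : Prop :=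
  Maximal (fun I : Submodule k[X] L => IsIdeal k I ∧ IsSolvable k I) R

/-- `L₁` is a direct summand of the conformal algebra `L₀`: `L₀ = L₁ ⊕ L₂` with `L₁`, `L₂` ideals
of `L₀`. -/
def IsSummand (L₀ L₁ : Submodule k[X] L) : Prop :=
  IsIdealOf k L₀ L₁ ∧
    ∃ L₂ : Submodule k[X] L, IsIdealOf k L₀ L₂ ∧ Disjoint L₁ L₂ ∧ L₁ ⊔ L₂ = L₀

/-- `M` is a conformal `A`-submodule of `L` under the adjoint action of the subalgebra `A`. -/
def IsSubmoduleOver (A M : Submodule k[X] L) : Prop := BracketLE k A M M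

/-- `M` is an irreducible conformal `A`-submodule of `L`: the action of `A` on `M` is nontrivial,
and `M` has no conformal `A`-submodules other than `0` and `M`. -/
def IsIrreducibleOver (A M : Submodule k[X] L) : Prop :=
  IsSubmoduleOver k A M ∧ ¬ BracketZero k A M ∧
    ∀ N : Submodule k[X] L, N ≤ M → IsSubmoduleOver k A N → N = ⊥ ∨ N = M

/-- The subalgebra `A` of `L` is isomorphic to the Lie conformal algebra `V`: there is an injective
`H`-linear map `V → L` that preserves the `λ`-brackets and has image `A`. -/
def IsIsomorphicTo (A : Submodule k[X] L) (V : Type w) [AddCommGroup V] [Module k V]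
    [Module k[X] V] [IsScalarTower k k[X] V] [LieConformalAlgebra k V] : Prop :=
  ∃ f : V →ₗ[k[X]] L, Function.Injective f ∧ LinearMap.range f = A ∧
    ∀ a b : V, br (k := k) (f a) (f b) = PolynomialModule.map k[X] f (br (k := k) a b)

end Notions

section Center

variable (k : Type u) (L : Type v) [Field k] [AddCommGroup L] [Module k L]
  [Module k[X] L] [IsScalarTower k k[X] L] [LieConformalAlgebra k L]

/-- The center `Z(L) = {a | [a_λ b] = 0 for all b}`. -/
def center : Submodule k[X] L where
  carrier := {a | ∀ b : L, br (k := k) a b = 0}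
  add_mem' := by
    intro a b ha hb c
    simp [ha c, hb c]
  zero_mem' := by intro b; simp
  smul_mem' := by
    intro p a ha b
    induction p using Polynomial.induction_on' with
    | add p q hp hq => rw [add_smul, map_add, LinearMap.add_apply, hp, hq, add_zero]
    | monomial n c =>
      rw [← C_mul_X_pow_eq_monomial, ← smul_eq_C_mul, smul_assoc, map_smul, LinearMap.smul_apply]
      suffices h : br (k := k) ((X : k[X]) ^ n • a) b = 0 by rw [h, smul_zero]
      induction n with
      | zero => simpa using ha b
      | succ n ih => rw [pow_succ', mul_smul, br_d_left, ih, smul_zero]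

end Center

/-! ### Lie conformal structures on free `H`-modules given on generators -/

section Generators

variable {k : Type u} [Field k]

/-- `f(∂) ↦ f(-λ)` -/
def sL : k[X] →ₐ[k] k[X][X] := aeval (-X : k[X][X])

/-- `f(∂) ↦ f(λ + ∂)` -/
def sR : k[X] →ₐ[k] k[X][X] := aeval (X + C X : k[X][X])

theorem sL_X : sL (X : k[X]) = -X := by simp [sL]

theorem sL_C (c : k) : sL (C c) = C (C c) := by simp [sL, Polynomial.algebraMap_apply]

theorem sR_X : sR (X : k[X]) = X + C X := by simp [sR]

theorem sR_C (c : k) : sR (C c) = C (C c) := by simp [sR, Polynomial.algebraMap_apply]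

variable {V : Type w} [AddCommGroup V] [Module k V]

/-- The sesquilinear extension to `H ⊗ V` of a `λ`-bracket given on the space of generators `V`:
`[f(∂) ⊗ v _λ g(∂) ⊗ w] = f(-λ) g(λ + ∂) [v_λ w]`. -/
def extendBracket (β : V →ₗ[k] V →ₗ[k] PolynomialModule k[X] (k[X] ⊗[k] V)) :
    k[X] ⊗[k] V →ₗ[k] k[X] ⊗[k] V →ₗ[k] PolynomialModule k[X] (k[X] ⊗[k] V) :=
  TensorProduct.lift (LinearMap.mk₂ k
    (fun f v => TensorProduct.lift (LinearMap.mk₂ k (fun g w => (sL f * sR g) • β v w)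
      (fun g g' w => by rw [map_add, mul_add, add_smul])
      (fun c g w => by rw [map_smul, mul_smul_comm, smul_assoc])
      (fun g w w' => by rw [map_add, smul_add])
      (fun c g w => by rw [map_smul, smul_comm])))
    (fun f f' v => by
      ext1; ext g w; simp [add_mul, add_smul])
    (fun c f v => by
      ext1; ext g w; simp [smul_assoc])
    (fun f v v' => by
      ext1; ext g w; simp [smul_add])
    (fun c f v => by
      ext1; ext g w; simp [smul_comm c]))

theorem extendBracket_tmul (β : V →ₗ[k] V →ₗ[k] PolynomialModule k[X] (k[X] ⊗[k] V))
    (f g : k[X]) (v w : V) :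
    extendBracket β (f ⊗ₜ v) (g ⊗ₜ w) = (sL f * sR g) • β v w := rfl

theorem extendBracket_smul_left (β : V →ₗ[k] V →ₗ[k] PolynomialModule k[X] (k[X] ⊗[k] V))
    (p : k[X]) (x y : k[X] ⊗[k] V) :
    extendBracket β (p • x) y = sL p • extendBracket β x y := by
  induction x with
  | zero => simp
  | add x x' hx hx' => simp only [smul_add, map_add, LinearMap.add_apply, hx, hx']
  | tmul f v =>
    induction y with
    | zero => simp
    | add y y' hy hy' => simp only [smul_add, map_add, hy, hy']
    | tmul g w =>
      rw [TensorProduct.smul_tmul', extendBracket_tmul, extendBracket_tmul, smul_eq_mul, map_mul,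
        smul_smul, mul_assoc]

theorem extendBracket_smul_right (β : V →ₗ[k] V →ₗ[k] PolynomialModule k[X] (k[X] ⊗[k] V))
    (p : k[X]) (x y : k[X] ⊗[k] V) :
    extendBracket β x (p • y) = sR p • extendBracket β x y := by
  induction x with
  | zero => simp
  | add x x' hx hx' => simp only [smul_add, map_add, LinearMap.add_apply, hx, hx']
  | tmul f v =>
    induction y with
    | zero => simp
    | add y y' hy hy' => simp only [smul_add, map_add, hy, hy']
    | tmul g w =>
      rw [TensorProduct.smul_tmul', extendBracket_tmul, extendBracket_tmul, smul_eq_mul, map_mul,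
        smul_smul, mul_left_comm]

theorem eval_sL (p r : k[X]) : (sL p).eval r = aeval (-r) p := by
  induction p using Polynomial.induction_on' with
  | add p q hp hq => simp [hp, hq]
  | monomial n c => simp [sL, aeval_monomial, Polynomial.algebraMap_apply]

theorem eval_sR (p r : k[X]) : (sR p).eval r = aeval (r + X) p := by
  induction p using Polynomial.induction_on' with
  | add p q hp hq => simp [hp, hq]
  | monomial n c => simp [sR, aeval_monomial, Polynomial.algebraMap_apply]

theorem aeval_aeval (p q r : k[X]) : aeval r (aeval q p) = aeval (aeval r q : k[X]) p := by
  rw [← Polynomial.aeval_algHom_apply]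

/-- A `λ`-bracket on generators whose sesquilinear extension is anti-commutative and satisfies the
Jacobi identity on the generators defines a Lie conformal algebra structure on `H ⊗ V`. -/
abbrev ofGenerators (β : V →ₗ[k] V →ₗ[k] PolynomialModule k[X] (k[X] ⊗[k] V))
    (hanti : ∀ (v w : V) (α : k),
      PolynomialModule.eval (C α) (β v w) = -PolynomialModule.eval (-X - C α) (β w v))
    (hjac : ∀ (u v w : V) (a b : k),
      PolynomialModule.eval (C a) (extendBracket β (1 ⊗ₜ u) (PolynomialModule.eval (C b) (β v w)))
      - PolynomialModule.eval (C b)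
          (extendBracket β (1 ⊗ₜ v) (PolynomialModule.eval (C a) (β u w)))
      = PolynomialModule.eval (C (a + b))
          (extendBracket β (PolynomialModule.eval (C a) (β u v)) (1 ⊗ₜ w))) :
    LieConformalAlgebra k (k[X] ⊗[k] V) where
  br := extendBracket β
  br_d_left a b := by rw [extendBracket_smul_left]; simp [sL]
  br_d_right a b := by rw [extendBracket_smul_right]; simp [sR]
  anticomm x y α := by
    induction x with
    | zero => simp
    | add x x' hx hx' => simp only [map_add, LinearMap.add_apply, hx, hx']; abel
    | tmul f v =>
      induction y with
      | zero => simp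
      | add y y' hy hy' => simp only [map_add, LinearMap.add_apply, hy, hy']; abel
      | tmul g w =>
        simp only [extendBracket_tmul, PolynomialModule.eval_smul, eval_mul, eval_sL, eval_sR,
          hanti v w, smul_neg]
        rw [mul_comm, show -(-X - C α) = C α + X by ring, show -X - C α + X = -C α by ring]
  jacobi x y z a b := by
    induction x with
    | zero => simp
    | add x x' hx hx' =>
      simp only [map_add, LinearMap.add_apply] at hx hx' ⊢
      rw [← hx, ← hx']; abel
    | tmul f u =>
      induction y with
      | zero => simp
      | add y y' hy hy' =>
        simp only [map_add, LinearMap.add_apply] at hy hy' ⊢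
        rw [← hy, ← hy']; abel
      | tmul g v =>
        induction z with
        | zero => simp
        | add z z' hz hz' =>
          simp only [map_add] at hz hz' ⊢
          rw [← hz, ← hz']; abel
        | tmul h w =>
          have e : ∀ (p : k[X]) (v : V), p ⊗ₜ[k] v = p • ((1 : k[X]) ⊗ₜ[k] v) := by
            intro p v; rw [TensorProduct.smul_tmul', smul_eq_mul, mul_one]
          have hb : ∀ v w : V, extendBracket β (1 ⊗ₜ v) (1 ⊗ₜ w) = β v w := by
            intro v w; rw [extendBracket_tmul]; simp
          rw [e f, e g, e h]
          simp only [extendBracket_smul_left, extendBracket_smul_right,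
            PolynomialModule.eval_smul, eval_sL, eval_sR, hb, aeval_aeval, map_add, map_neg,
            aeval_X, aeval_C, Polynomial.algebraMap_eq]
          have h1 := hjac u v w a b
          rw [show C b + (C a + X) = C a + C b + (X : k[X]) by ring,
            show C a + (C b + X) = C a + C b + (X : k[X]) by ring,
            show C a + -(C a + C b) = -(C b : k[X]) by ring, ← map_add C a b, ← h1, smul_sub,
            smul_sub, smul_sub]
          congr 1
          module

end Generators

/-! ### The Virasoro conformal algebra and `Vir ⋉ Cur g` -/

section Examples

variable (k : Type u) [Field k]

/-- The constant polynomial `x ∈ L ⊆ L[λ]`, as a `k`-linear map on generators. -/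
def const (V : Type w) [AddCommGroup V] [Module k V] :
    V →ₗ[k] PolynomialModule k[X] (k[X] ⊗[k] V) :=
  ((PolynomialModule.lsingle k[X] 0).restrictScalars k).comp (TensorProduct.mk k k[X] V 1)

/-- The free `H`-module of rank one `H ⊗ k` underlying `Vir`. -/
def Vir : Type u := k[X] ⊗[k] k

instance : AddCommGroup (Vir k) := inferInstanceAs (AddCommGroup (k[X] ⊗[k] k))
instance : Module k (Vir k) := inferInstanceAs (Module k (k[X] ⊗[k] k))
instance : Module k[X] (Vir k) := inferInstanceAs (Module k[X] (k[X] ⊗[k] k))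
instance : IsScalarTower k k[X] (Vir k) := inferInstanceAs (IsScalarTower k k[X] (k[X] ⊗[k] k))

/-- The bracket on the generators of `Vir`: `[s v_λ t v] = s t (∂ + 2λ) v`, where `v = 1`. -/
def virGen : k →ₗ[k] k →ₗ[k] PolynomialModule k[X] (k[X] ⊗[k] k) :=
  LinearMap.mk₂ k (fun s t => (s * t) • ((C X + 2 * X : k[X][X]) • const k k 1))
    (fun s s' t => by rw [add_mul, add_smul])
    (fun c s t => by rw [smul_eq_mul, mul_assoc, mul_smul])
    (fun s t t' => by rw [mul_add, add_smul])
    (fun c s t => by rw [smul_eq_mul, mul_left_comm, mul_smul])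

theorem eval_const (p : k[X]) (V : Type w) [AddCommGroup V] [Module k V] (x : V) :
    PolynomialModule.eval p (const k V x) = 1 ⊗ₜ x := by
  simp [const]

theorem extendBracket_one {V : Type w} [AddCommGroup V] [Module k V]
    (β : V →ₗ[k] V →ₗ[k] PolynomialModule k[X] (k[X] ⊗[k] V)) (v w : V) :
    extendBracket β (1 ⊗ₜ v) (1 ⊗ₜ w) = β v w := by
  rw [extendBracket_tmul]; simp

theorem eval_virGen (p : k[X]) (s t : k) :
    PolynomialModule.eval p (virGen k s t)
      = (C s * C t * (X + 2 * p) : k[X]) • (1 : k[X]) ⊗ₜ[k] (1 : k) := by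
  rw [virGen, LinearMap.mk₂_apply, LinearMap.map_smul_of_tower, PolynomialModule.eval_smul,
    eval_const, algebra_compatible_smul k[X] (s * t), smul_smul]
  simp

/-- The Virasoro conformal algebra `Vir = H v`, `[v_λ v] = (∂ + 2λ) v`. -/
instance : LieConformalAlgebra k (Vir k) :=
  ofGenerators (virGen k)
    (fun s t α => by
      simp only [eval_virGen]
      module)
    (fun s t r a b => by
      simp only [eval_virGen, extendBracket_smul_left, extendBracket_smul_right,
        PolynomialModule.eval_smul, sL_X, sL_C, sR_X, sR_C, extendBracket_one, map_add, map_mul,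
        eval_add, eval_mul, eval_neg, eval_X, eval_C, eval_ofNat,
        map_ofNat]
      module)

variable (g : Type w) [LieRing g] [LieAlgebra k g]

/-- The free `H`-module `H ⊗ (k v ⊕ g) = H v ⊕ (H ⊗ g)` underlying `Vir ⋉ Cur g`. -/
def VirCur : Type (max u w) := k[X] ⊗[k] (k × g)

instance : AddCommGroup (VirCur k g) := inferInstanceAs (AddCommGroup (k[X] ⊗[k] (k × g)))
instance : Module k (VirCur k g) := inferInstanceAs (Module k (k[X] ⊗[k] (k × g)))
instance : Module k[X] (VirCur k g) := inferInstanceAs (Module k[X] (k[X] ⊗[k] (k × g)))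
instance : IsScalarTower k k[X] (VirCur k g) :=
  inferInstanceAs (IsScalarTower k k[X] (k[X] ⊗[k] (k × g)))

/-- The bracket on the generators of `Vir ⋉ Cur g`:
`[s v + x _λ t v + y] = s t (∂ + 2λ) v + s (∂ + λ) y + t λ x + [x, y]`, that is `[v_λ v] = (∂ + 2λ) v`,
`[v_λ y] = (∂ + λ) y`, `[x_λ v] = λ x` (as anti-commutativity forces) and `[x_λ y] = [x, y]`. -/
def virCurGen :
    (k × g) →ₗ[k] (k × g) →ₗ[k] PolynomialModule k[X] (k[X] ⊗[k] (k × g)) :=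
  LinearMap.mk₂ k (fun a b =>
      (a.1 * b.1) • ((C X + 2 * X : k[X][X]) • const k (k × g) (1, 0))
      + a.1 • ((C X + X : k[X][X]) • const k (k × g) (0, b.2))
      + b.1 • ((X : k[X][X]) • const k (k × g) (0, a.2))
      + const k (k × g) (0, ⁅a.2, b.2⁆))
    (fun a a' b => by
      have h : ∀ x y : g, ((0 : k), x + y) = (0, x) + (0, y) := by simp
      simp only [Prod.fst_add, Prod.snd_add, add_lie, h, map_add]
      module)
    (fun c a b => by
      have h : ∀ x : g, ((0 : k), c • x) = c • (0, x) := by simp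
      simp only [Prod.smul_fst, Prod.smul_snd, smul_lie, h, map_smul, smul_eq_mul,
        smul_comm (X : k[X][X]) c]
      module)
    (fun a b b' => by
      have h : ∀ x y : g, ((0 : k), x + y) = (0, x) + (0, y) := by simp
      simp only [Prod.fst_add, Prod.snd_add, lie_add, h, map_add]
      module)
    (fun c a b => by
      have h : ∀ x : g, ((0 : k), c • x) = c • (0, x) := by simp
      simp only [Prod.smul_fst, Prod.smul_snd, lie_smul, h, map_smul, smul_eq_mul,
        smul_comm (C X + X : k[X][X]) c]
      module)

theorem eval_virCurGen (p : k[X]) (a b : k × g) :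
    PolynomialModule.eval p (virCurGen k g a b)
      = (C a.1 * C b.1 * (X + 2 * p) : k[X]) • (1 : k[X]) ⊗ₜ[k] ((1 : k), (0 : g))
        + (C a.1 * (X + p) : k[X]) • (1 : k[X]) ⊗ₜ[k] ((0 : k), b.2)
        + (C b.1 * p : k[X]) • (1 : k[X]) ⊗ₜ[k] ((0 : k), a.2)
        + (1 : k[X]) ⊗ₜ[k] ((0 : k), ⁅a.2, b.2⁆) := by
  rw [virCurGen, LinearMap.mk₂_apply]
  simp only [map_add, LinearMap.map_smul_of_tower, PolynomialModule.eval_smul, eval_const,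
    algebra_compatible_smul k[X] (_ : k), smul_smul]
  simp

/-- The Lie conformal algebra `Vir ⋉ Cur g`. -/
instance : LieConformalAlgebra k (VirCur k g) :=
  ofGenerators (virCurGen k g)
    (fun a b α => by
      have h : ∀ x : g, (1 : k[X]) ⊗ₜ[k] ((0 : k), -x) = -((1 : k[X]) ⊗ₜ[k] ((0 : k), x)) := by
        intro x; rw [← TensorProduct.tmul_neg]; simp
      rw [eval_virCurGen, eval_virCurGen, ← lie_skew, h]
      module)
    (fun a b c α β => by
      have h : ∀ x y : g, (1 : k[X]) ⊗ₜ[k] ((0 : k), x + y)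
          = (1 : k[X]) ⊗ₜ[k] ((0 : k), x) + (1 : k[X]) ⊗ₜ[k] ((0 : k), y) := by
        intro x y; rw [← TensorProduct.tmul_add]; simp
      have h' : ∀ x : g, (1 : k[X]) ⊗ₜ[k] ((0 : k), -x) = -((1 : k[X]) ⊗ₜ[k] ((0 : k), x)) := by
        intro x; rw [← TensorProduct.tmul_neg]; simp
      have h0 : (1 : k[X]) ⊗ₜ[k] ((0 : k), (0 : g)) = 0 := TensorProduct.tmul_zero _ _
      simp only [eval_virCurGen, extendBracket_smul_left, extendBracket_smul_right,
        PolynomialModule.eval_smul, sL_X, sL_C, sR_X, sR_C, extendBracket_one, map_add, map_mul,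
        eval_add, eval_mul, eval_neg, eval_X, eval_C, eval_ofNat,
        LinearMap.add_apply, map_ofNat, map_zero,
        map_one, lie_zero, zero_lie, h0, leibniz_lie a.2 b.2 c.2, h]
      have e : (1 : k[X]) ⊗ₜ[k] ((0 : k), ⁅b.2, a.2⁆)
          = -((1 : k[X]) ⊗ₜ[k] ((0 : k), ⁅a.2, b.2⁆)) := by rw [← lie_skew, h']
      rw [e]
      module)

end Examples

end LieConformalAlgebra

end

/-! Write D = `shift v` = v_0 − ∂, where v ∈ L₁ is the Virasoro generator. In both types of L₁ one
has [v_0 a] = ∂a for all a ∈ L₁. Hence D is H-linear on L and commutes with the action of L₁. Since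
L is finite over H, a monic polynomial χ over H annihilates D. As L is torsion-free, such polynomial
relations force brackets to vanish.

Let m be the last index at which L₁ acts nontrivially on the lower central series of R. Minimality
of rank gives a submodule I of that term with no smaller nontrivial submodule. Some D − α is not
surjective on I, so its image is a trivial submodule; since I = [L₁, I], it follows that D = α on I,
that is, [v_0 u] = (∂ + α)u. A trivial submodule of I is then killed by ∂ + α and vanishes, so I is
irreducible (`exists_irreducible_submodule`).

It remains to see that R and the complement L₂ of L₁ in L₀ kill I. For r ∈ R the bracket [r_β u]
lies in the next term, where v acts by zero; Jacobi turns D on r into −(∂ + α) on [r_β u], and χ(D)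
= 0 gives a nonzero polynomial in ∂ killing it (`br_eq_zero_of_brAt_zero`). For b ∈ L₂, [b_β u]
would be an eigenvector of D with eigenvalue α + β for every β, while D has finitely many
eigenvalues (`br_eq_zero_of_commute`). Thus I is an ideal of L. -/

noncomputable section

namespace LieConformalAlgebra

/-! ### Values of the λ-bracket at scalars, and the action on torsion -/

section Evaluation

/-- A polynomial with coefficients in a vector space over an infinite field vanishes if all its
values at constants vanish. -/
theorem _root_.PolynomialModule.eq_zero_of_eval_C_eq_zero {k : Type u} {M : Type v} [Field k]
    [Infinite k] [AddCommGroup M] [Module k M] [Module k[X] M] [IsScalarTower k k[X] M]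
    (p : PolynomialModule k[X] M) (s : Set k) (hs : s.Infinite)
    (h : ∀ α ∈ s, PolynomialModule.eval (C α) p = 0) : p = 0 := by
  ext n
  rw [PolynomialModule.coeff_zero, Finsupp.zero_apply,
    ← Module.forall_dual_apply_eq_zero_iff k]
  intro φ
  -- Applying a `k`-linear functional coefficientwise reduces to an ordinary polynomial with
  -- infinitely many roots.
  have hq : (∑ i ∈ p.coeff.support, monomial i (φ (p.coeff i)) : k[X]) = 0 := by
    refine Polynomial.eq_zero_of_infinite_isRoot _ (hs.mono fun α hα => ?_)
    have h1 := congrArg φ (h α hα)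
    rw [PolynomialModule.eval_apply, Finsupp.sum, map_sum, map_zero] at h1
    simp only [Set.mem_ofPred_eq, IsRoot.def, eval_finsetSum, eval_monomial]
    rw [← h1]
    refine Finset.sum_congr rfl fun i _ => ?_
    rw [← C_pow, ← mul_one (C (α ^ i)), ← smul_eq_C_mul, smul_assoc, one_smul, map_smul,
      smul_eq_mul, mul_comm]
  have h2 := congrArg (fun q => q.coeff n) hq
  simp only [finsetSum_coeff, coeff_monomial, coeff_zero, Finset.sum_ite_eq',
    Finsupp.mem_support_iff] at h2
  by_cases hn : p.coeff n = 0
  · simp [hn]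
  · simpa [hn] using h2

theorem _root_.PolynomialModule.eval_mem {k : Type u} {M : Type v} [Field k]
    [AddCommGroup M] [Module k[X] M] (N : Submodule k[X] M)
    (p : PolynomialModule k[X] M) (h : ∀ n, p.coeff n ∈ N) (q : k[X]) :
    PolynomialModule.eval q p ∈ N := by
  rw [PolynomialModule.eval_apply]
  exact N.sum_mem fun i _ => N.smul_mem _ (h i)

/-- Reduction modulo `N` turns membership into vanishing. This makes the coefficientwise notions
interchangeable with conditions on the values [a_α b], where the Jacobi identity is available. -/
theorem _root_.PolynomialModule.coeff_mem_of_eval_C_mem {k : Type u} {M : Type v} [Field k]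
    [Infinite k] [AddCommGroup M] [Module k M] [Module k[X] M] [IsScalarTower k k[X] M]
    (N : Submodule k[X] M) (p : PolynomialModule k[X] M)
    (h : ∀ α : k, PolynomialModule.eval (C α) p ∈ N) (n : ℕ) : p.coeff n ∈ N := by
  have h0 : PolynomialModule.map k[X] N.mkQ p = 0 := by
    refine PolynomialModule.eq_zero_of_eval_C_eq_zero _ Set.univ Set.infinite_univ fun α _ => ?_
    have := PolynomialModule.eval_map k[X] N.mkQ p (C α)
    rw [Algebra.algebraMap_self, RingHom.id_apply] at this
    rw [this, Submodule.mkQ_apply, Submodule.Quotient.mk_eq_zero]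
    exact h α
  have h1 := congrArg (fun q => q.coeff n) h0
  simpa [PolynomialModule.map] using h1

theorem C_smul_eq {k : Type u} {M : Type v} [Field k] [AddCommGroup M] [Module k M]
    [Module k[X] M] [IsScalarTower k k[X] M] (c : k) (x : M) : (C c : k[X]) • x = c • x := by
  rw [← mul_one (C c), ← smul_eq_C_mul, smul_assoc, one_smul]

variable (k : Type u) {L : Type v} [Field k] [AddCommGroup L] [Module k L]
  [Module k[X] L] [IsScalarTower k k[X] L] [LieConformalAlgebra k L]

/-- The value `[a_α b]` of the `λ`-bracket at `λ = α ∈ k`. -/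
def brAt (α : k) : L →ₗ[k] L →ₗ[k] L :=
  (br (k := k)).compr₂ ((PolynomialModule.eval (C α)).restrictScalars k)

variable {k}

theorem brAt_apply (α : k) (a b : L) :
    brAt k α a b = PolynomialModule.eval (C α) (br (k := k) a b) := rfl

theorem brAt_X_smul_left (α : k) (a b : L) :
    brAt k α ((X : k[X]) • a) b = -((C α : k[X]) • brAt k α a b) := by
  rw [brAt_apply, br_d_left, PolynomialModule.eval_smul, brAt_apply]
  simp

theorem brAt_X_smul_right (α : k) (a b : L) :
    brAt k α a ((X : k[X]) • b) = (X + C α : k[X]) • brAt k α a b := by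
  rw [brAt_apply, br_d_right, PolynomialModule.eval_smul, brAt_apply]
  simp [add_comm]

theorem brAt_smul_left (α : k) (p : k[X]) (a b : L) :
    brAt k α (p • a) b = (C (p.eval (-α)) : k[X]) • brAt k α a b := by
  induction p using Polynomial.induction_on generalizing a with
  | C c => simp [C_smul_eq]
  | add p q hp hq => rw [add_smul, map_add, LinearMap.add_apply, hp, hq, eval_add, C_add, add_smul]
  | monomial n c ih =>
    rw [pow_succ, ← mul_assoc, mul_smul, ih, brAt_X_smul_left, ← neg_smul, smul_smul, ← C_neg,
      ← C_mul, ← eval_mul_X]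

theorem brAt_smul_right (α : k) (p : k[X]) (a b : L) :
    brAt k α a (p • b) = p.comp (X + C α) • brAt k α a b := by
  induction p using Polynomial.induction_on generalizing b with
  | C c => simp [C_smul_eq]
  | add p q hp hq => rw [add_smul, map_add, hp, hq, add_comp, add_smul]
  | monomial n c ih =>
    rw [pow_succ, ← mul_assoc, mul_smul, ih, brAt_X_smul_right, smul_smul, mul_comp _ X, X_comp]

theorem brAt_jacobi (α β : k) (a b c : L) :
    brAt k α a (brAt k β b c) - brAt k β b (brAt k α a c)
      = brAt k (α + β) (brAt k α a b) c :=
  jacobi a b c α β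

theorem br_eq_zero_of_brAt [Infinite k] (a b : L) (s : Set k) (hs : s.Infinite)
    (h : ∀ α ∈ s, brAt k α a b = 0) : br (k := k) a b = 0 :=
  PolynomialModule.eq_zero_of_eval_C_eq_zero _ s hs h

theorem bracketZero_iff [Infinite k] {A B : Submodule k[X] L} :
    BracketZero k A B ↔ ∀ a ∈ A, ∀ b ∈ B, ∀ α : k, brAt k α a b = 0 :=
  ⟨fun h a ha b hb α => by rw [brAt_apply, h a ha b hb, map_zero],
    fun h a ha b hb => br_eq_zero_of_brAt a b Set.univ Set.infinite_univ fun α _ => h a ha b hb α⟩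

theorem bracketLE_iff [Infinite k] {A B N : Submodule k[X] L} :
    BracketLE k A B N ↔ ∀ a ∈ A, ∀ b ∈ B, ∀ α : k, brAt k α a b ∈ N :=
  ⟨fun h a ha b hb _ => PolynomialModule.eval_mem N _ (h a ha b hb) _,
    fun h a ha b hb => PolynomialModule.coeff_mem_of_eval_C_mem N _ (h a ha b hb)⟩

theorem bracketLE_bracketSpan (A B : Submodule k[X] L) : BracketLE k A B (bracketSpan k A B) :=
  fun a ha b hb n => Submodule.subset_span ⟨a, ha, b, hb, n, rfl⟩

theorem bracketSpan_le {A B N : Submodule k[X] L} (h : BracketLE k A B N) :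
    bracketSpan k A B ≤ N :=
  Submodule.span_le.2 fun _ ⟨a, ha, b, hb, n, hn⟩ => hn ▸ h a ha b hb n

/-- The elements that are mapped into `N` by all `[a_α ·]`, `a ∈ A`. -/
def transporter (A N : Submodule k[X] L) : Submodule k[X] L where
  carrier := {x | ∀ a ∈ A, ∀ α : k, brAt k α a x ∈ N}
  add_mem' hx hy a ha α := by rw [map_add]; exact N.add_mem (hx a ha α) (hy a ha α)
  zero_mem' a ha α := by rw [map_zero]; exact N.zero_mem
  smul_mem' p x hx a ha α := by rw [brAt_smul_right]; exact N.smul_mem _ (hx a ha α)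

theorem mem_transporter {A N : Submodule k[X] L} {x : L} :
    x ∈ transporter A N ↔ ∀ a ∈ A, ∀ α : k, brAt k α a x ∈ N := Iff.rfl

theorem bracketLE_iff_le_transporter [Infinite k] {A B N : Submodule k[X] L} :
    BracketLE k A B N ↔ B ≤ transporter A N :=
  bracketLE_iff.trans ⟨fun h b hb a ha α => h a ha b hb α, fun h _ ha _ hb α => h hb _ ha α⟩

theorem mem_transporter_of_X_sub_C_smul [Infinite k] {A N : Submodule k[X] L} (c : k) {x : L}
    (h : (X - C c : k[X]) • x ∈ transporter A N) : x ∈ transporter A N := by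
  intro a ha
  have h0 : br (k := k) a ((X - C c : k[X]) • x)
      = (X + C (X - C c) : k[X][X]) • br (k := k) a x := by
    rw [sub_smul, map_sub, br_d_right, C_smul_eq, map_smul, C_sub, ← add_sub_assoc, sub_smul]
    congr 1
    refine PolynomialModule.coeff_injective (Finsupp.ext fun n => ?_)
    rw [← monomial_zero_left, PolynomialModule.monomial_smul_apply]
    rw [if_pos (Nat.zero_le n), Nat.sub_zero]
    exact (C_smul_eq c _).symm
  have h1 : ∀ n, (br (k := k) a ((X - C c : k[X]) • x)).coeff n ∈ N :=
    PolynomialModule.coeff_mem_of_eval_C_mem N _ (h a ha)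
  -- The coefficient of λ^(n+1) in (λ + ∂ − c)[a_λ x] is x_n + (∂ − c)x_{n+1}, where x_i are the
  -- coefficients of [a_λ x]. Membership in `N` therefore descends from above the degree, where the
  -- coefficients are zero.
  have h2 : ∀ n, (br (k := k) a x).coeff (n + 1) ∈ N → (br (k := k) a x).coeff n ∈ N := by
    intro n hn
    have h3 := h1 (n + 1)
    rw [h0, add_smul, ← monomial_zero_left, ← monomial_one_one_eq_X,
      PolynomialModule.coeff_add, Finsupp.add_apply, PolynomialModule.monomial_smul_apply,
      PolynomialModule.monomial_smul_apply] at h3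
    simp only [le_add_iff_nonneg_left, zero_le, if_true, Nat.add_sub_cancel, one_smul,
      tsub_zero] at h3
    exact (N.add_mem_iff_left (N.smul_mem _ hn)).1 h3
  have h4 : ∀ j n, (br (k := k) a x).coeff (n + j) ∈ N → (br (k := k) a x).coeff n ∈ N := by
    intro j
    induction j with
    | zero => exact fun n h => h
    | succ j ih => exact fun n h => ih n (h2 _ h)
  refine fun α => PolynomialModule.eval_mem N _ (fun n => ?_) _
  obtain ⟨D, hD⟩ := (br (k := k) a x).coeff.support.bddAbove
  refine h4 (D + 1) n ?_
  have : (br (k := k) a x).coeff (n + (D + 1)) = 0 := by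
    by_contra hne
    have := hD (Finsupp.mem_support_iff.2 hne)
    omega
  rw [this]
  exact N.zero_mem

/-- The `λ`-action on a torsion element is trivial: if `f • x` acts into `N`, so does `x`. -/
theorem mem_transporter_of_smul [IsAlgClosed k] {A N : Submodule k[X] L} {f : k[X]} (hf : f ≠ 0)
    {x : L} (h : f • x ∈ transporter A N) : x ∈ transporter A N := by
  have hprod : ∀ (s : Multiset k) (x : L),
      (s.map fun c => (X - C c : k[X])).prod • x ∈ transporter A N → x ∈ transporter A N := by
    intro s
    induction s using Multiset.induction_on with
    | empty => intro x hx; simpa using hx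
    | cons c s ih =>
      intro x hx
      rw [Multiset.map_cons, Multiset.prod_cons, mul_comm, mul_smul] at hx
      exact mem_transporter_of_X_sub_C_smul c (ih _ hx)
  refine hprod f.roots x ?_
  have h1 := (IsAlgClosed.splits f).eq_prod_roots
  have h2 : (C f.leadingCoeff : k[X]) • ((f.roots.map fun c => (X - C c : k[X])).prod • x)
      ∈ transporter A N := by
    rw [smul_smul, ← h1]; exact h
  have h3 := (transporter A N).smul_mem (C f.leadingCoeff⁻¹ : k[X]) h2
  rwa [smul_smul, ← C_mul, inv_mul_cancel₀ (leadingCoeff_ne_zero.2 hf), C_1, one_smul] at h3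

end Evaluation

end LieConformalAlgebra

/-! ### Eigenvalues modulo ∂ of endomorphisms over `k[X]` -/

/-- An endomorphism of a nonzero finite torsion-free `k[X]`-module has a shift by a scalar that is
not surjective. -/
theorem Module.End.exists_not_surjective_sub_C {k : Type u} {M : Type v} [Field k] [IsAlgClosed k]
    [AddCommGroup M] [Module k[X] M] [Module.Finite k[X] M] [Module.IsTorsionFree k[X] M]
    [Nontrivial M] (φ : Module.End k[X] M) :
    ∃ α : k, ¬ Function.Surjective fun x => φ x - (C α : k[X]) • x := by
  by_contra! hsurj
  let _ : Module k M := Module.compHom M (C : k →+* k[X])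
  have : IsScalarTower k k[X] M := ⟨fun c p x => by
    rw [smul_eq_C_mul, mul_smul]; rfl⟩
  obtain ⟨p, hp, hp0⟩ := LinearMap.exists_monic_and_aeval_eq_zero k[X] φ
  -- `p₀` is `p` at ∂ = 0. It splits over `k`, so `p₀(φ)` is invertible if every φ − α is. But p(φ)
  -- = 0 makes `p₀(φ)` divisible by ∂, whence M = ∂M, which Nakayama's lemma and torsion-freeness
  -- exclude.
  set p₀ : k[X] := p.map (evalRingHom 0) with hp₀
  have hmonic : p₀.Monic := hp.map _
  obtain ⟨q, hq⟩ : C (X : k[X]) ∣ p - p₀.map C := by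
    rw [C_dvd_iff_dvd_coeff]
    intro i
    rw [X_dvd_iff, hp₀]
    simp [coeff_map, coeff_zero_eq_eval_zero]
  have hunit : IsUnit (aeval φ p₀) := by
    by_contra hnu
    rw [(IsAlgClosed.splits p₀).eq_prod_roots, hmonic.leadingCoeff, C_1, one_mul] at hnu
    obtain ⟨α, hα, -⟩ := spectrum.exists_mem_of_not_isUnit_aeval_prod hnu
    rw [spectrum.mem_iff] at hα
    refine hα ?_
    have hs : Function.Surjective (φ - algebraMap k (Module.End k[X] M) α) := hsurj α
    have hi := IsNoetherian.injective_of_surjective_endomorphism _ hs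
    rw [← IsUnit.neg_iff, neg_sub]
    exact (Module.End.isUnit_iff _).2 ⟨hi, hs⟩
  have hrange : ∀ x : M, x ∈ Ideal.span {(X : k[X])} • (⊤ : Submodule k[X] M) := by
    intro x
    obtain ⟨y, rfl⟩ := ((Module.End.isUnit_iff _).1 hunit).2 x
    have h1 : aeval φ (p₀.map (C : k →+* k[X])) = aeval φ p₀ :=
      Polynomial.aeval_map_algebraMap k[X] φ p₀
    have h2 := congrArg (fun r => aeval φ r y) hq
    simp only [map_sub, map_mul, hp0, h1, zero_sub, aeval_C, LinearMap.neg_apply,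
      Module.End.mul_apply, Module.algebraMap_end_apply] at h2
    rw [← neg_neg (aeval φ p₀ y), h2, ← smul_neg]
    exact Submodule.smul_mem_smul (Ideal.mem_span_singleton_self _) trivial
  obtain ⟨r, hr, hr0⟩ := Submodule.exists_sub_one_mem_and_smul_eq_zero_of_fg_of_le_smul
    (Ideal.span {(X : k[X])}) (⊤ : Submodule k[X] M) Module.Finite.fg_top fun x _ => hrange x
  obtain ⟨x, hx⟩ := exists_ne (0 : M)
  obtain rfl : r = 0 := (smul_eq_zero.1 (hr0 x trivial)).resolve_right hx
  rw [Ideal.mem_span_singleton, X_dvd_iff] at hr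
  simp at hr

namespace LieConformalAlgebra

/-! ### The operator v_0 − ∂ and irreducible submodules -/

section Shift

variable {k : Type u} {L : Type v} [Field k] [AddCommGroup L] [Module k L]
  [Module k[X] L] [IsScalarTower k k[X] L] [LieConformalAlgebra k L]

/-- The `H`-linear map `b ↦ [v_0 b] - ∂ b`. -/
def shift (v : L) : Module.End k[X] L where
  toFun b := brAt k 0 v b - (X : k[X]) • b
  map_add' b c := by rw [map_add, smul_add]; abel
  map_smul' p b := by
    rw [brAt_smul_right, C_0, add_zero, comp_X, smul_comm, ← smul_sub, RingHom.id_apply]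

theorem shift_apply (v b : L) : shift (k := k) v b = brAt k 0 v b - (X : k[X]) • b := rfl

theorem brAt_zero_eq (v b : L) : brAt k 0 v b = shift (k := k) v b + (X : k[X]) • b := by
  rw [shift_apply, sub_add_cancel]

theorem shift_mem {v : L} {N : Submodule k[X] L} {x : L} (hx : x ∈ N) (h : brAt k 0 v x ∈ N) :
    shift (k := k) v x ∈ N :=
  N.sub_mem h (N.smul_mem _ hx)

/-- If `[v_0 a] = ∂ a`, then `b ↦ [v_0 b] - ∂ b` commutes with the action of `a`. -/
theorem shift_brAt {v a : L} (ha : brAt k 0 v a = (X : k[X]) • a) (μ : k) (x : L) :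
    shift (k := k) v (brAt k μ a x) = brAt k μ a (shift (k := k) v x) := by
  -- Jacobi gives [v_0 [a_μ x]] = [a_μ [v_0 x]] − μ[a_μ x]; the term −μ is absorbed by [a_μ ∂x] = (∂
  -- + μ)[a_μ x].
  have h := brAt_jacobi 0 μ v a x
  rw [ha, zero_add, brAt_X_smul_left, sub_eq_iff_eq_add] at h
  rw [shift_apply, h, shift_apply, map_sub, brAt_X_smul_right]
  module

variable {A : Submodule k[X] L} {v : L}

/-- Jacobi writes [(∂a)_μ x] = −μ[a_μ x] through brackets of `A` with [A, N], which vanish. So [a_μ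
x] = 0 for all μ ≠ 0, and these values determine the bracket. Passing to [A, N] thus never loses
nontriviality. -/
theorem bracketZero_of_bracketZero_bracketSpan [Infinite k] {N : Submodule k[X] L}
    (hv : v ∈ A) (hA : ∀ a ∈ A, brAt k 0 v a = (X : k[X]) • a)
    (hN : BracketLE k A N N) (h : BracketZero k A (bracketSpan k A N)) : BracketZero k A N := by
  intro a ha x hx
  have hmem := bracketLE_iff.1 (bracketLE_bracketSpan (k := k) A N)
  have hsub := bracketLE_iff.1 hN
  have hz := bracketZero_iff.1 h
  refine br_eq_zero_of_brAt a x {0}ᶜ (Set.finite_singleton 0).infinite_compl fun μ hμ => ?_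
  have hj := brAt_jacobi 0 μ v a x
  rw [hz v hv _ (hmem a ha x hx μ), hA a ha, zero_add, brAt_X_smul_left, C_smul_eq] at hj
  have h3 : brAt k μ a (brAt k 0 v x) = 0 := hz a ha _ (hmem v hv x hx 0) μ
  rw [h3, sub_zero, eq_comm, neg_eq_zero, smul_eq_zero] at hj
  exact hj.resolve_left hμ

variable [Module.Finite k[X] L]

/-- A nontrivial finite module contains a nontrivial submodule `M` all of whose
submodules are trivial or equal to `M`. -/
theorem exists_minimal_nontrivial_submodule [IsAlgClosed k] {N : Submodule k[X] L}
    (hv : v ∈ A) (hA : ∀ a ∈ A, brAt k 0 v a = (X : k[X]) • a)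
    (hN : IsSubmoduleOver k A N) (hnt : ¬ BracketZero k A N) :
    ∃ M ≤ N, IsSubmoduleOver k A M ∧ ¬ BracketZero k A M ∧
      ∀ M' ≤ M, IsSubmoduleOver k A M' → ¬ BracketZero k A M' → M' = M := by
  obtain ⟨N₀, ⟨hN₀, hs₀, hnt₀⟩, hmin⟩ := exists_minimalFor_of_wellFoundedLT
    (fun N' : Submodule k[X] L => N' ≤ N ∧ IsSubmoduleOver k A N' ∧ ¬ BracketZero k A N')
    (fun N' => Module.finrank k[X] N') ⟨N, le_rfl, hN, hnt⟩
  have hle : bracketSpan k A N₀ ≤ N₀ := bracketSpan_le hs₀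
  -- `N₀` itself may have proper nontrivial submodules of the same rank; [A, N₀] does not. Such an
  -- `M'` has torsion quotient in `N₀`, and torsion is acted on trivially, so `A` maps `N₀` into
  -- `M'`.
  refine ⟨bracketSpan k A N₀, hle.trans hN₀,
    fun a ha x hx => bracketLE_bracketSpan A N₀ a ha x (hle hx),
    fun h => hnt₀ (bracketZero_of_bracketZero_bracketSpan hv hA hs₀ h), ?_⟩
  intro M' hM' hsub hM'nt
  refine le_antisymm hM' (bracketSpan_le (bracketLE_iff_le_transporter.2 fun x hx => ?_))
  have hrank : Module.finrank k[X] N₀ ≤ Module.finrank k[X] M' :=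
    hmin ⟨(hM'.trans hle).trans hN₀, hsub, hM'nt⟩ (Submodule.finrank_mono (hM'.trans hle))
  have hq := Submodule.finrank_quotient_add_finrank (M'.submoduleOf N₀)
  rw [(Submodule.submoduleOfEquivOfLe (hM'.trans hle)).finrank_eq] at hq
  have htors := Module.finrank_eq_zero_iff_isTorsion.1
    (show Module.finrank k[X] (N₀ ⧸ M'.submoduleOf N₀) = 0 by omega)
  obtain ⟨⟨f, hf⟩, hfx⟩ := @htors (Submodule.Quotient.mk ⟨x, hx⟩)
  have hfx' : (f • (⟨x, hx⟩ : N₀)) ∈ M'.submoduleOf N₀ :=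
    (Submodule.Quotient.mk_eq_zero _).1 hfx
  exact mem_transporter_of_smul (nonZeroDivisors.ne_zero hf)
    (bracketLE_iff_le_transporter.1 hsub hfx')

variable [Module.IsTorsionFree k[X] L]

/-- An element that commutes with `v` under the bracket at `0` annihilates every eigenvector of
`b ↦ [v_0 b] - ∂ b`. -/
theorem br_eq_zero_of_commute [Infinite k] {b u : L} {α : k} (hb : brAt k 0 v b = 0)
    (hu : shift (k := k) v u = (C α : k[X]) • u) : br (k := k) b u = 0 := by
  obtain ⟨χ, hχ, hχ0⟩ := LinearMap.exists_monic_and_aeval_eq_zero k[X] (shift (k := k) v)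
  -- Since v_0 commutes with `b`, it acts on [b_β u] by (∂ + α) shifted to ∂ + β + α. Different β
  -- give different eigenvalues, each a root of χ.
  have hE : ∀ β : k, shift (k := k) v (brAt k β b u) = (C (α + β) : k[X]) • brAt k β b u := by
    intro β
    have hj := brAt_jacobi 0 β v b u
    rw [hb, map_zero, LinearMap.zero_apply, sub_eq_zero, brAt_zero_eq v u, hu, ← add_smul,
      brAt_smul_right] at hj
    rw [shift_apply, hj, ← sub_smul]
    congr 1
    simp
    ring
  have hfin : {β : k | χ.IsRoot (C (α + β))}.Finite := by
    refine Set.Finite.preimage (f := fun β => (C (α + β) : k[X])) (s := {p | χ.IsRoot p})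
      (fun x _ y _ hxy => ?_) (Polynomial.finite_setOfPred_isRoot hχ.ne_zero)
    exact add_left_cancel (C_injective hxy)
  refine br_eq_zero_of_brAt b u _ hfin.infinite_compl fun β hβ => ?_
  by_contra hne
  have := Module.End.aeval_apply_of_hasEigenvector (p := χ)
    (Module.End.hasEigenvector_iff.2 ⟨Module.End.mem_eigenspace_iff.2 (hE β), hne⟩)
  rw [hχ0, LinearMap.zero_apply, eq_comm, smul_eq_zero] at this
  exact this.elim hβ hne

/-- If `v_0` acts trivially on `[R_λ u]`, where `u` is an eigenvector of `b ↦ [v_0 b] - ∂ b`,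
then `[R_λ u] = 0`. -/
theorem br_eq_zero_of_brAt_zero [Infinite k] {R : Submodule k[X] L} {u : L} {α : k}
    (hR : ∀ r ∈ R, shift (k := k) v r ∈ R)
    (h : ∀ r ∈ R, ∀ β : k, brAt k 0 v (brAt k β r u) = 0)
    (hu : shift (k := k) v u = (C α : k[X]) • u) {r : L} (hr : r ∈ R) :
    br (k := k) r u = 0 := by
  obtain ⟨χ, hχ, hχ0⟩ := LinearMap.exists_monic_and_aeval_eq_zero k[X] (shift (k := k) v)
  refine br_eq_zero_of_brAt r u Set.univ Set.infinite_univ fun β _ => ?_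
  -- With [v_0 [r_β u]] = 0, Jacobi leaves [(Dr)_β u] = β[r_β u] − (∂ + β + α)[r_β u], and the β
  -- cancel.
  have hstep : ∀ r ∈ R, brAt k β (shift (k := k) v r) u = (-(X + C α) : k[X]) • brAt k β r u := by
    intro r hr
    have hj := brAt_jacobi 0 β v r u
    rw [h r hr, zero_sub, zero_add, brAt_zero_eq v u, hu, ← add_smul, brAt_smul_right,
      brAt_zero_eq v r, map_add, LinearMap.add_apply, brAt_X_smul_left, ← sub_eq_add_neg,
      eq_comm, sub_eq_iff_eq_add] at hj
    rw [hj, ← neg_smul, ← add_smul]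
    congr 1
    simp
    ring
  -- A coefficient c(∂) of `q` acts on the left argument, hence becomes the scalar c(−β); D becomes
  -- −(∂ + α).
  have hpoly : ∀ q : k[X][X], ∀ r ∈ R, brAt k β (aeval (shift (k := k) v) q r) u
      = (q.map (evalRingHom (-β))).comp (-(X + C α)) • brAt k β r u := by
    intro q
    induction q using Polynomial.induction_on with
    | C c =>
      intro r hr
      rw [aeval_C, Module.algebraMap_end_apply, brAt_smul_left]
      simp
    | add p q hp hq =>
      intro r hr
      rw [map_add, LinearMap.add_apply, map_add, LinearMap.add_apply, hp r hr, hq r hr,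
        Polynomial.map_add, add_comp, add_smul]
    | monomial n c ih =>
      intro r hr
      rw [pow_succ, ← mul_assoc, map_mul, Module.End.mul_apply, aeval_X, ih _ (hR r hr),
        hstep r hr, smul_smul, Polynomial.map_mul _ (q := X), map_X, mul_comp, X_comp]
  have h0 := hpoly χ r hr
  rw [hχ0, LinearMap.zero_apply, map_zero, LinearMap.zero_apply, eq_comm, smul_eq_zero,
    comp_eq_zero_iff] at h0
  rcases h0 with (h0 | ⟨-, h0⟩) | h0
  -- A monic χ stays nonzero after evaluating its coefficients; substituting the nonconstant −(∂ +
  -- α) preserves this.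
  · exact absurd h0 (hχ.map _).ne_zero
  · have := congrArg (fun p => p.coeff 1) h0
    simp [coeff_X, coeff_C] at this
  · exact h0

/-- A nontrivial finite torsion-free module contains an irreducible submodule, on which
`b ↦ [v_0 b] - ∂ b` acts by a scalar. -/
theorem exists_irreducible_submodule [IsAlgClosed k] {N : Submodule k[X] L}
    (hv : v ∈ A) (hA : ∀ a ∈ A, brAt k 0 v a = (X : k[X]) • a)
    (hN : IsSubmoduleOver k A N) (hnt : ¬ BracketZero k A N) :
    ∃ I ≤ N, IsIrreducibleOver k A I ∧
      ∃ α : k, ∀ u ∈ I, shift (k := k) v u = (C α : k[X]) • u := by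
  obtain ⟨M, hMN, hM, hMnt, hmin⟩ := exists_minimal_nontrivial_submodule hv hA hN hnt
  have hM' := bracketLE_iff.1 hM
  have hne : Nontrivial M := by
    rw [Submodule.nontrivial_iff_ne_bot]
    rintro rfl
    refine hMnt fun a _ x hx => ?_
    rw [(Submodule.mem_bot _).1 hx, map_zero]
  have hshift : ∀ x ∈ M, shift (k := k) v x ∈ M := fun x hx => shift_mem hx (hM' v hv x hx 0)
  obtain ⟨α, hα⟩ := Module.End.exists_not_surjective_sub_C ((shift (k := k) v).restrict hshift)
  set ψ : Module.End k[X] L := shift v - (C α : k[X]) • LinearMap.id with hψ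
  have hψ_apply : ∀ x, ψ x = shift (k := k) v x - (C α : k[X]) • x := fun x => rfl
  have hcomm : ∀ a ∈ A, ∀ μ x, brAt k μ a (ψ x) = ψ (brAt k μ a x) := by
    intro a ha μ x
    rw [hψ_apply, hψ_apply, map_sub, shift_brAt (hA a ha), C_smul_eq, C_smul_eq, map_smul]
  have hmap_le : M.map ψ ≤ M := by
    rintro _ ⟨x, hx, rfl⟩
    exact M.sub_mem (hshift x hx) (M.smul_mem _ hx)
  have hmap_sub : IsSubmoduleOver k A (M.map ψ) := by
    refine bracketLE_iff.2 ?_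
    rintro a ha _ ⟨x, hx, rfl⟩ μ
    rw [hcomm a ha]
    exact Submodule.mem_map_of_mem (hM' a ha x hx μ)
  -- If the image were nontrivial, minimality would make it all of `M`, against the choice of `α`.
  have hmap_zero : BracketZero k A (M.map ψ) := by
    by_contra hcon
    have heq := hmin _ hmap_le hmap_sub hcon
    refine hα fun y => ?_
    obtain ⟨x, hx, hxy⟩ : (y : L) ∈ M.map ψ := heq.ge y.2
    exact ⟨⟨x, hx⟩, Subtype.ext hxy⟩
  have hspan_le : bracketSpan k A M ≤ M := bracketSpan_le hM
  have hspan : bracketSpan k A M = M := hmin _ hspan_le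
    (fun a ha x hx => bracketLE_bracketSpan A M a ha x (hspan_le hx))
    fun h => hMnt (bracketZero_of_bracketZero_bracketSpan hv hA hM h)
  have hscalar : ∀ u ∈ M, shift (k := k) v u = (C α : k[X]) • u := by
    have hker : bracketSpan k A M ≤ LinearMap.ker ψ := by
      refine bracketSpan_le (bracketLE_iff.2 fun a ha x hx μ => ?_)
      rw [LinearMap.mem_ker, ← hcomm a ha]
      exact bracketZero_iff.1 hmap_zero a ha _ (Submodule.mem_map_of_mem hx) μ
    intro u hu
    rw [hspan] at hker
    exact sub_eq_zero.1 (hker hu)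
  refine ⟨M, hMN, ⟨hM, hMnt, fun N' hN' hsub => ?_⟩, α, hscalar⟩
  -- On a trivial submodule v_0 = 0, so D = α reads (∂ + α)x = 0.
  by_cases hz : BracketZero k A N'
  · refine Or.inl ((Submodule.eq_bot_iff _).2 fun x hx => ?_)
    have h1 := hscalar x (hN' hx)
    rw [shift_apply, bracketZero_iff.1 hz v hv x hx, zero_sub, neg_eq_iff_add_eq_zero,
      ← add_smul, smul_eq_zero] at h1
    exact h1.resolve_left (X_add_C_ne_zero α)
  · exact Or.inr (hmin N' hN' hsub hz)

end Shift

end LieConformalAlgebra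

namespace LieConformalAlgebra

/-! ### Stability of the lower central series; commuting ideals -/

section LowerCentralSeries

variable {k : Type u} {L : Type v} [Field k] [AddCommGroup L] [Module k L]
  [Module k[X] L] [IsScalarTower k k[X] L] [LieConformalAlgebra k L]

theorem bracketSpan_bot (A : Submodule k[X] L) : bracketSpan k A ⊥ = ⊥ := by
  refine le_bot_iff.1 (bracketSpan_le fun a _ b hb n => ?_)
  rw [(Submodule.mem_bot _).1 hb, map_zero]
  exact Submodule.zero_mem _

theorem lowerCentralSeries_eq_bot_of_le {R : Submodule k[X] L} {n m : ℕ} (hnm : n ≤ m)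
    (h : lowerCentralSeries k R n = ⊥) : lowerCentralSeries k R m = ⊥ := by
  induction m, hnm using Nat.le_induction with
  | base => exact h
  | succ m _ ih => rw [lowerCentralSeries, ih, bracketSpan_bot]

/-- Submodules over `A` are closed under the bracket. -/
theorem IsSubmoduleOver.bracketSpan [Infinite k] {A M N : Submodule k[X] L} (hM : IsSubmoduleOver k A M)
    (hN : IsSubmoduleOver k A N) :
    IsSubmoduleOver k A (LieConformalAlgebra.bracketSpan k M N) := by
  refine bracketLE_iff_le_transporter.2
    (bracketSpan_le (bracketLE_iff.2 fun x hx y hy β a ha α => ?_))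
  have hmem := bracketLE_iff.1 (bracketLE_bracketSpan (k := k) M N)
  rw [sub_eq_iff_eq_add.1 (brAt_jacobi α β a x y)]
  exact Submodule.add_mem _ (hmem _ (bracketLE_iff.1 hM a ha x hx α) y hy _)
    (hmem x hx _ (bracketLE_iff.1 hN a ha y hy α) _)

theorem IsSubmoduleOver.lowerCentralSeries [Infinite k] {A R : Submodule k[X] L} (hR : IsSubmoduleOver k A R)
    (n : ℕ) : IsSubmoduleOver k A (LieConformalAlgebra.lowerCentralSeries k R n) := by
  induction n with
  | zero => exact hR
  | succ n ih => exact hR.bracketSpan ih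

/-- Ideals of a subalgebra with zero intersection commute. -/
theorem bracketZero_of_disjoint [Infinite k] {A I J : Submodule k[X] L} (hI : IsIdealOf k A I)
    (hJ : IsIdealOf k A J) (h : Disjoint I J) : BracketZero k I J := by
  refine bracketZero_iff.2 fun a ha b hb α => ?_
  refine (Submodule.disjoint_def.1 h) _ ?_ (bracketLE_iff.1 hJ.2 a (hI.1 ha) b hb α)
  rw [brAt_apply, anticomm]
  exact I.neg_mem (PolynomialModule.eval_mem I _ (hI.2 b (hJ.1 hb) a ha) _)

end LowerCentralSeries

/-! ### An element acting as ∂ at λ = 0 -/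

section Virasoro

/-- An isomorphism transports an element `v` with `[v_0 a] = ∂ a` for all `a`. -/
theorem IsIsomorphicTo.exists_brAt_zero_eq {k : Type u} {L : Type v} [Field k]
    [AddCommGroup L] [Module k L] [Module k[X] L] [IsScalarTower k k[X] L]
    [LieConformalAlgebra k L] {V : Type w} [AddCommGroup V] [Module k V]
    [Module k[X] V] [IsScalarTower k k[X] V] [LieConformalAlgebra k V] {A : Submodule k[X] L}
    (hA : IsIsomorphicTo k A V) (hV : ∃ v : V, ∀ a : V, brAt k 0 v a = (X : k[X]) • a) :
    ∃ v ∈ A, ∀ a ∈ A, brAt k 0 v a = (X : k[X]) • a := by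
  obtain ⟨f, -, rfl, hf⟩ := hA
  obtain ⟨v, hv⟩ := hV
  refine ⟨f v, ⟨v, rfl⟩, ?_⟩
  rintro _ ⟨a, rfl⟩
  have h := PolynomialModule.eval_map k[X] f (br (k := k) v a) (C 0)
  rw [Algebra.algebraMap_self, RingHom.id_apply] at h
  rw [brAt_apply, hf, h, ← brAt_apply, hv, map_smul]

variable (k : Type u) [Field k]

/-- At λ = 0 sesquilinearity in the right argument is plain H-linearity, and ∂ + 2λ becomes ∂ on the
generator. -/
theorem exists_brAt_zero_eq_vir : ∃ v : Vir k, ∀ a : Vir k, brAt k 0 v a = (X : k[X]) • a := by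
  refine ⟨((1 : k[X]) ⊗ₜ[k] (1 : k) : k[X] ⊗[k] k), fun a => ?_⟩
  change PolynomialModule.eval (C 0) (extendBracket (virGen k) (1 ⊗ₜ 1) a) = _
  induction a using TensorProduct.induction_on with
  | zero => rw [map_zero, map_zero]; exact (smul_zero _).symm
  | add a b ha hb => rw [map_add, map_add, ha, hb]; exact (smul_add _ _ _).symm
  | tmul f t =>
    rw [extendBracket_tmul, PolynomialModule.eval_smul, eval_virGen]
    change _ = (X : k[X]) • (f ⊗ₜ[k] t : k[X] ⊗[k] k)
    have h1 : (f ⊗ₜ[k] t : k[X] ⊗[k] k) = (f * C t : k[X]) • (1 : k[X]) ⊗ₜ[k] (1 : k) := by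
      rw [TensorProduct.smul_tmul', smul_eq_mul, mul_one, mul_comm, ← smul_eq_C_mul,
        TensorProduct.smul_tmul, smul_eq_mul, mul_one]
    rw [h1, smul_smul, smul_smul]
    congr 1
    simp [eval_sR]
    ring

/-- Both ∂ + 2λ and ∂ + λ specialize to ∂ at λ = 0, so the conformal weights of the generators play
no role. -/
theorem exists_brAt_zero_eq_virCur (g : Type w) [LieRing g] [LieAlgebra k g] :
    ∃ v : VirCur k g, ∀ a : VirCur k g, brAt k 0 v a = (X : k[X]) • a := by
  refine ⟨((1 : k[X]) ⊗ₜ[k] ((1 : k), (0 : g)) : k[X] ⊗[k] (k × g)), fun a => ?_⟩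
  change PolynomialModule.eval (C 0) (extendBracket (virCurGen k g) (1 ⊗ₜ (1, 0)) a) = _
  induction a using TensorProduct.induction_on with
  | zero => rw [map_zero, map_zero]; exact (smul_zero _).symm
  | add a b ha hb => rw [map_add, map_add, ha, hb]; exact (smul_add _ _ _).symm
  | tmul f t =>
    obtain ⟨t, y⟩ := t
    rw [extendBracket_tmul, PolynomialModule.eval_smul, eval_virCurGen]
    change _ = (X : k[X]) • (f ⊗ₜ[k] (t, y) : k[X] ⊗[k] (k × g))
    have hsplit : (f ⊗ₜ[k] (t, y) : k[X] ⊗[k] (k × g))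
        = f • ((C t : k[X]) • (1 : k[X]) ⊗ₜ[k] ((1 : k), (0 : g))
          + (1 : k[X]) ⊗ₜ[k] ((0 : k), y)) := by
      have h1 : (t, y) = t • ((1 : k), (0 : g)) + (0, y) := by simp
      rw [h1, TensorProduct.tmul_add, TensorProduct.tmul_smul, smul_add, TensorProduct.smul_tmul',
        TensorProduct.smul_tmul', TensorProduct.smul_tmul', TensorProduct.smul_tmul']
      simp [smul_eq_C_mul, mul_comm]
    have h0 : (1 : k[X]) ⊗ₜ[k] ((0 : k), (0 : g)) = 0 := TensorProduct.tmul_zero _ _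
    rw [hsplit]
    simp [eval_sR, h0, smul_smul]
    module

end Virasoro

end LieConformalAlgebra

end

/-! ### The theorem -/

theorem mainTheorem3 (k : Type u) (L : Type v) [Field k] [IsAlgClosed k] [CharZero k]
    [AddCommGroup L] [Module k L] [Module k[X] L] [IsScalarTower k k[X] L]
    [LieConformalAlgebra k L] [Module.Finite k[X] L] [Module.IsTorsionFree k[X] L]
    (R L₀ L₁ : Submodule k[X] L)
    (hR : LieConformalAlgebra.IsRadical k R)
    (hL₀ : LieConformalAlgebra.IsSubalgebra k L₀)
    (hss : LieConformalAlgebra.IsSemisimple k L₀)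
    (hsplit : IsCompl L₀ R)
    (hnil : LieConformalAlgebra.IsNilpotent k R)
    (hL₁ : LieConformalAlgebra.IsSummand k L₀ L₁)
    (htype : LieConformalAlgebra.IsIsomorphicTo k L₁ (LieConformalAlgebra.Vir k) ∨
      ∃ (g : Type w) (_ : LieRing g) (_ : LieAlgebra k g),
        Module.Finite k g ∧ LieAlgebra.IsSimple k g ∧
          LieConformalAlgebra.IsIsomorphicTo k L₁ (LieConformalAlgebra.VirCur k g))
    (hnontriv : ¬ LieConformalAlgebra.BracketZero k L₁ R) :
    ∃ m : ℕ, ¬ LieConformalAlgebra.BracketZero k L₁ (LieConformalAlgebra.lowerCentralSeries k R m) ∧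
      (∀ n, m < n →
        LieConformalAlgebra.BracketZero k L₁ (LieConformalAlgebra.lowerCentralSeries k R n)) ∧
      ∃ I : Submodule k[X] L, I ≠ ⊥ ∧ LieConformalAlgebra.IsIdeal k I ∧
        I ⊓ LieConformalAlgebra.center k L = ⊥ ∧
        LieConformalAlgebra.BracketZero k R I ∧
        I ≤ LieConformalAlgebra.lowerCentralSeries k R m ∧
        LieConformalAlgebra.IsIrreducibleOver k L₁ I := by
  classical
  obtain ⟨v, hv, hA⟩ : ∃ v ∈ L₁, ∀ a ∈ L₁,
      LieConformalAlgebra.brAt k 0 v a = (X : k[X]) • a := by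
    rcases htype with h | ⟨g, _, _, -, -, h⟩
    · exact h.exists_brAt_zero_eq (LieConformalAlgebra.exists_brAt_zero_eq_vir k)
    · exact h.exists_brAt_zero_eq (LieConformalAlgebra.exists_brAt_zero_eq_virCur k g)
  have hRideal : ∀ A : Submodule k[X] L, LieConformalAlgebra.IsSubmoduleOver k A R :=
    fun A a _ b hb n => hR.prop.1.2 a trivial b hb n
  have hRsub := fun (A : Submodule k[X] L) (n : ℕ) => (hRideal A).lowerCentralSeries n
  obtain ⟨N, hN⟩ := hnil
  have hzero_of_le : ∀ n, N ≤ n → LieConformalAlgebra.BracketZero k L₁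
      (LieConformalAlgebra.lowerCentralSeries k R n) := by
    intro n hn a _ b hb
    rw [LieConformalAlgebra.lowerCentralSeries_eq_bot_of_le hn hN, Submodule.mem_bot] at hb
    rw [hb, map_zero]
  let P : ℕ → Prop := fun n => ¬ LieConformalAlgebra.BracketZero k L₁
    (LieConformalAlgebra.lowerCentralSeries k R n)
  set m := Nat.findGreatest P N
  -- The term of index 0 is `R`, on which `L₁` acts nontrivially, so the search has a starting
  -- point.
  have hPm : P m := Nat.findGreatest_spec (P := P) (Nat.zero_le N) hnontriv
  have hlast : ∀ n, m < n → LieConformalAlgebra.BracketZero k L₁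
      (LieConformalAlgebra.lowerCentralSeries k R n) := by
    intro n hn
    rcases le_total N n with h | h
    · exact hzero_of_le n h
    · exact not_not.1 (Nat.findGreatest_is_greatest (P := P) hn h)
  obtain ⟨I, hIm, hirr, α, hα⟩ :=
    LieConformalAlgebra.exists_irreducible_submodule hv hA (hRsub L₁ m) hPm
  have hRI : LieConformalAlgebra.BracketZero k R I := by
    intro r hr u hu
    refine LieConformalAlgebra.br_eq_zero_of_brAt_zero (v := v) (R := R)
      (fun r hr => LieConformalAlgebra.shift_mem hr
        (LieConformalAlgebra.bracketLE_iff.1 (hRideal L₁) v hv r hr 0))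
      (fun r hr β => ?_) (hα u hu) hr
    exact LieConformalAlgebra.bracketZero_iff.1 (hlast (m + 1) (Nat.lt_succ_self m)) v hv _
      (LieConformalAlgebra.bracketLE_iff.1
        (LieConformalAlgebra.bracketLE_bracketSpan (k := k) R _) r hr u (hIm hu) β) 0
  obtain ⟨hL₁ideal, L₂, hL₂, hdisj, hsup⟩ := hL₁
  have hL₂I : LieConformalAlgebra.BracketZero k L₂ I := by
    intro b hb u hu
    refine LieConformalAlgebra.br_eq_zero_of_commute (v := v) ?_ (hα u hu)
    exact LieConformalAlgebra.bracketZero_iff.1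
      (LieConformalAlgebra.bracketZero_of_disjoint hL₁ideal hL₂ hdisj) v hv b hb 0
  have hIideal : LieConformalAlgebra.IsIdeal k I := by
    refine ⟨le_top, LieConformalAlgebra.bracketLE_iff.2 fun a _ u hu β => ?_⟩
    obtain ⟨a₀, ha₀, r, hr, rfl⟩ := Submodule.mem_sup.1
      (hsplit.sup_eq_top.ge (Submodule.mem_top (x := a)))
    rw [← hsup] at ha₀
    obtain ⟨a₁, ha₁, a₂, ha₂, rfl⟩ := Submodule.mem_sup.1 ha₀
    rw [map_add, map_add, LinearMap.add_apply, LinearMap.add_apply,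
      LieConformalAlgebra.bracketZero_iff.1 hL₂I a₂ ha₂ u hu,
      LieConformalAlgebra.bracketZero_iff.1 hRI r hr u hu, add_zero, add_zero]
    exact LieConformalAlgebra.bracketLE_iff.1 hirr.1 a₁ ha₁ u hu β
  have hne : I ≠ ⊥ := by
    rintro rfl
    refine hirr.2.1 fun a _ b hb => ?_
    rw [(Submodule.mem_bot _).1 hb, map_zero]
  refine ⟨m, hPm, hlast, I, hne, hIideal, ?_, hRI, hIm, hirr⟩
  -- Central elements form a trivial part of `I`; irreducibility then leaves 0, since `I` itself is
  -- nontrivial.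
  have hcenter : LieConformalAlgebra.BracketZero k L₁
      (I ⊓ LieConformalAlgebra.center k L) := by
    refine LieConformalAlgebra.bracketZero_iff.2 fun a _ z hz β => ?_
    rw [LieConformalAlgebra.brAt_apply, LieConformalAlgebra.anticomm, hz.2 a, map_zero, neg_zero]
  rcases hirr.2.2 _ inf_le_left (fun a ha z hz n => by
    rw [hcenter a ha z hz]; exact Submodule.zero_mem _) with h | h
  · exact h
  · exact absurd (h ▸ hcenter) hirr.2.1
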